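/- Let $G$ be a connected real Lie group of finite dimension with Lie algebra $\mathfrak g$, and let $\alpha\in\mathfrak g^*$ be non-zero. Put $d\alpha(X,Y)=-\alpha([X,Y])$ and $A(d\alpha)=\{X\in\mathfrak g : d\alpha(X,Y)=0 \text{ for all } Y\in\mathfrak g\}$. The Cartan class $\operatorname{cl}(\alpha)$ of $\alpha$ is the codimension of $\ker\alpha\cap A(d\alpha)$ in $\mathfrak g$. Let $\mathcal O(\alpha)=\{\alpha\circ \operatorname{Ad}(x^{-1}) : x\in G\}\subset\mathfrak g^*$ be the coadjoint orbit of $\alpha$, with its usual structure of a smooth manifold (the one for which the orbit map $G\to\mathcal O(\alpha)$, $x\mapsto\alpha\circ\operatorname{Ad}(x^{-1})$, is a submersion and the inclusion $\mathcal O(\alpha)\to\mathfrak g^*$ is an immersion). Then: 1. for every integer $p\ge 0$, $\dim\mathcal O(\alpha)=2p$ if and only if $\operatorname{cl}(\alpha)=2p$ or $\operatorname{cl}(\alpha)=2p+1$; 2. $\dim\mathcal O(\alpha)=2\left\lfloor \operatorname{cl}(\alpha)/2\right\rfloor$; 3. the tangent space to $\mathcal O(\alpha)$ at the point $\alpha$,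 regarded as a subspace of $\mathfrak g^*$, is $A^*(d\alpha)=\{\beta\in\mathfrak g^* : \beta(X)=0 \text{ for all } X\in A(d\alpha)\}$. -/

import Mathlib

open scoped Manifold ContDiff

noncomputable section

namespace CoadjointClass

section CartanClass

variable {K L : Type*} [Field K] [LieRing L] [LieAlgebra K L]

/-- The differential of a linear form `α` on a Lie algebra, as a bilinear form:
`dα(X, Y) = -α([X, Y])`. -/
def extDiff (α : Module.Dual K L) : L →ₗ[K] L →ₗ[K] K :=
  LinearMap.mk₂ K (fun X Y => -α ⁅X, Y⁆)
    (fun X X' Y => by rw [add_lie, map_add, neg_add])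
    (fun c X Y => by rw [smul_lie, map_smul, smul_neg])
    (fun X Y Y' => by rw [lie_add, map_add, neg_add])
    (fun c X Y => by rw [lie_smul, map_smul, smul_neg])

/-- The associated subspace `A(dα) = {X | i(X)dα = 0}` of `dα`. -/
def assocSpace (α : Module.Dual K L) : Submodule K L := LinearMap.ker (extDiff α)

/-- The characteristic space `A(α) ∩ A(dα)` of `α`, with `A(α) = {X | α(X) = 0}`. -/
def charSpace (α : Module.Dual K L) : Submodule K L := LinearMap.ker α ⊓ assocSpace α

/-- The Cartan class of a linear form: the codimension of its characteristic space. -/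
def cartanClass (α : Module.Dual K L) : ℕ := Module.finrank K (L ⧸ charSpace α)

end CartanClass

/-- Over `ℝ`, the smoothness that the Lie bracket on the tangent space at the identity asks for is
implied by `C^∞`. -/
instance leInftyMinSmoothness : ENat.LEInfty (minSmoothness ℝ 3) :=
  ⟨by
    rw [minSmoothness_of_isRCLikeNormedField]
    exact (inferInstance : ENat.LEInfty (3 : WithTop ℕ∞)).out⟩

section CoadjointOrbit

variable {E : Type*} [NormedAddCommGroup E] [NormedSpace ℝ E]
  {G : Type*} [TopologicalSpace G] [ChartedSpace E G] [Group G]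

variable (E) in
/-- The adjoint representation: `Ad(x)` is the tangent map at the identity of `y ↦ x y x⁻¹`. -/
def Ad (x : G) : GroupLieAlgebra 𝓘(ℝ, E) G →L[ℝ] GroupLieAlgebra 𝓘(ℝ, E) G :=
  mfderiv 𝓘(ℝ, E) 𝓘(ℝ, E) (fun y : G => x * y * x⁻¹) 1

/-- The coadjoint representation: `⟨Ad*(x)α, X⟩ = ⟨α, Ad(x⁻¹)X⟩`. The Lie algebra `𝔤` of `G` is the
tangent space at the identity, whose underlying vector space is the model space `E`; its dual `𝔤*`
is therefore written `E →L[ℝ] ℝ`. -/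
def coAd (x : G) (α : E →L[ℝ] ℝ) : E →L[ℝ] ℝ :=
  ContinuousLinearMap.comp α (Ad E x⁻¹ : E →L[ℝ] E)

variable (G) in
/-- An element of `𝔤*`, seen as a linear form on the Lie algebra of `G`. -/
def toLinearForm (α : E →L[ℝ] ℝ) : Module.Dual ℝ (GroupLieAlgebra 𝓘(ℝ, E) G) :=
  α.toLinearMap

variable (G) in
/-- The coadjoint orbit `𝒪(α)`, as a type that carries no topology a priori: an orbit need not be
an embedded submanifold of `𝔤*`, so its manifold topology may be finer than the one induced
by `𝔤*`. -/
def CoadjointOrbit (α : E →L[ℝ] ℝ) : Type _ := {β : E →L[ℝ] ℝ // ∃ x : G, coAd x α = β}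

/-- The inclusion `𝒪(α) → 𝔤*`. -/
def orbitIncl (α : E →L[ℝ] ℝ) (β : CoadjointOrbit G α) : E →L[ℝ] ℝ := β.1

/-- The orbit map `G → 𝒪(α)`, `x ↦ Ad*(x)α`. -/
def orbitMap (α : E →L[ℝ] ℝ) (x : G) : CoadjointOrbit G α := ⟨coAd x α, x, rfl⟩

theorem Ad_one : Ad E (1 : G) = ContinuousLinearMap.id ℝ _ := by
  have h : (fun y : G => (1 : G) * y * (1 : G)⁻¹) = id := by
    funext y
    simp
  unfold Ad
  rw [h]
  exact mfderiv_id

theorem coAd_one (α : E →L[ℝ] ℝ) : coAd (1 : G) α = α := by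
  unfold coAd
  rw [inv_one, Ad_one]
  rfl

variable (G) in
/-- The point `α` of the orbit `𝒪(α)`. -/
def orbitBase (α : E →L[ℝ] ℝ) : CoadjointOrbit G α := ⟨α, 1, coAd_one α⟩

variable (G) in
/-- The given topology and atlas make `𝒪(α)` a smooth manifold of dimension `d`, in the way usual
for an orbit of a Lie group: a smooth, Hausdorff, second countable manifold, immersed in `𝔤*` by the
inclusion, and such that the orbit map `G → 𝒪(α)` is a submersion. (The last condition determines
the smooth structure, because a surjective submersion does.) -/
structure IsOrbitManifold (α : E →L[ℝ] ℝ) (d : ℕ) [TopologicalSpace (CoadjointOrbit G α)]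
    [ChartedSpace (EuclideanSpace ℝ (Fin d)) (CoadjointOrbit G α)] : Prop where
  isManifold : IsManifold (𝓡 d) ∞ (CoadjointOrbit G α)
  t2 : T2Space (CoadjointOrbit G α)
  secondCountable : SecondCountableTopology (CoadjointOrbit G α)
  contMDiff_incl : ContMDiff (𝓡 d) 𝓘(ℝ, E →L[ℝ] ℝ) ∞ (orbitIncl (G := G) α)
  injective_incl : ∀ β : CoadjointOrbit G α,
    Function.Injective (mfderiv (𝓡 d) 𝓘(ℝ, E →L[ℝ] ℝ) (orbitIncl (G := G) α) β)
  contMDiff_orbitMap : ContMDiff 𝓘(ℝ, E) (𝓡 d) ∞ (orbitMap (G := G) α)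
  surjective_orbitMap : ∀ x : G,
    Function.Surjective (mfderiv 𝓘(ℝ, E) (𝓡 d) (orbitMap (G := G) α) x)

variable (G) in
/-- `dim 𝒪(α) = d`: the orbit, with its manifold structure, is a manifold of dimension `d`. -/
def OrbitHasDim (α : E →L[ℝ] ℝ) (d : ℕ) : Prop :=
  ∃ (_ : TopologicalSpace (CoadjointOrbit G α))
    (_ : ChartedSpace (EuclideanSpace ℝ (Fin d)) (CoadjointOrbit G α)), IsOrbitManifold G α d

variable (G) in
/-- The tangent space to `𝒪(α)` at the point `α`, as a subspace of `𝔤*`: the image of the tangent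
map of the inclusion `𝒪(α) → 𝔤*`. -/
def orbitTangentSpace (α : E →L[ℝ] ℝ) (d : ℕ) [TopologicalSpace (CoadjointOrbit G α)]
    [ChartedSpace (EuclideanSpace ℝ (Fin d)) (CoadjointOrbit G α)] : Set (E →L[ℝ] ℝ) :=
  Set.range fun v : TangentSpace (𝓡 d) (orbitBase G α) =>
    (mfderiv (𝓡 d) 𝓘(ℝ, E →L[ℝ] ℝ) (orbitIncl (G := G) α) (orbitBase G α) v : E →L[ℝ] ℝ)

end CoadjointOrbit

end CoadjointClass

end

/-! Everything reduces to one linear map, the differential at the identity of `x ↦ Ad*(x)α`. Since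
the differential of `Ad` at the identity is the bracket, this map is `X ↦ dα(X, ·)`
(`coadDeriv_apply`). A submersive orbit map followed by an immersive inclusion gives, by the chain
rule, a factorisation J ∘ Q with J injective and Q surjective (`IsOrbitManifold.exists_comp`). So in
any admissible structure the dimension is the rank of dα and the tangent space at α is its range,
which is the annihilator of the kernel A(dα) because dα is alternating (`range_extDiff`).

The rank of an alternating form is even, and cutting A(dα) by ker α lowers its dimension by at most
one. The rank is therefore cl(α) or cl(α) - 1, and parity makes it 2⌊cl(α)/2⌋
(`finrank_range_extDiff`).

As `OrbitHasDim` is existential, a manifold structure must also be built. The orbit gets the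
quotient topology. By equivariance the orbit map has constant rank, so near the identity it factors
through a linear projection of 𝔤* with a smooth section (`exists_section_of_constant_rank`).
Translates of that projection are the charts (`nonempty_immersedAtlas`). Connectedness of G yields
second countability. -/

noncomputable section

namespace CoadjointClass

/-! ### Alternating forms, their rank, and the Cartan class -/

section LinearAlgebra

open Module

/-- On a complement of the kernel the form is nondegenerate, so its Gram matrix M is invertible.
Skew-symmetry gives det M = (-1)^r det M with r the rank, which excludes odd r. -/
theorem even_finrank_range_of_isAlt {K V : Type*} [Field K] [CharZero K] [AddCommGroup V]
    [Module K V] [FiniteDimensional K V] {B : V →ₗ[K] V →ₗ[K] K} (hB : B.IsAlt) :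
    Even (finrank K (LinearMap.range B)) := by
  obtain ⟨C, hC⟩ := (LinearMap.ker B).exists_isCompl
  set B' : C →ₗ[K] C →ₗ[K] K := B.domRestrict₁₂ C C
  have hsep : B'.SeparatingLeft := by
    intro x hx
    have hker : (x : V) ∈ LinearMap.ker B := by
      rw [LinearMap.mem_ker]
      ext v
      have hv : v ∈ LinearMap.ker B ⊔ C := by rw [hC.sup_eq_top]; trivial
      obtain ⟨k, hk, c, hc, rfl⟩ := Submodule.mem_sup.1 hv
      have h1 : B x k = 0 := by rw [← hB.neg, LinearMap.mem_ker.1 hk]; simp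
      have h2 : B x c = 0 := hx ⟨c, hc⟩
      simp [h1, h2]
    have : (x : V) ∈ LinearMap.ker B ⊓ C := ⟨hker, x.2⟩
    rw [hC.inf_eq_bot] at this
    exact Subtype.ext ((Submodule.mem_bot K).1 this)
  have hfin : finrank K (LinearMap.range B) = finrank K C := by
    have h1 := Submodule.finrank_add_eq_of_isCompl hC
    have h2 := B.finrank_range_add_finrank_ker
    omega
  let b := Module.finBasis K C
  let M := LinearMap.toMatrix₂ b b B'
  have hdet : M.det ≠ 0 :=
    (LinearMap.separatingLeft_iff_det_ne_zero b).1 hsep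
  have hM : M.transpose = -M := by
    ext i j
    simp only [M, Matrix.transpose_apply, Matrix.neg_apply, LinearMap.toMatrix₂_apply]
    exact (hB.neg _ _).symm
  have hdet' : M.det = (-1) ^ finrank K C * M.det := by
    conv_lhs => rw [← Matrix.det_transpose, hM, Matrix.det_neg, Fintype.card_fin]
  rw [hfin]
  by_contra hodd
  rw [Nat.not_even_iff_odd] at hodd
  rw [hodd.neg_one_pow, neg_one_mul] at hdet'
  exact hdet (self_eq_neg.1 hdet')

variable {K L : Type*} [Field K] [LieRing L] [LieAlgebra K L]

theorem extDiff_apply (α : Module.Dual K L) (X Y : L) : extDiff α X Y = -α ⁅X, Y⁆ := rfl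

theorem extDiff_isAlt (α : Module.Dual K L) : (extDiff α).IsAlt := fun X => by
  rw [extDiff_apply, lie_self, map_zero, neg_zero]

theorem range_extDiff [FiniteDimensional K L] (α : Module.Dual K L) :
    LinearMap.range (extDiff α) = (assocSpace α).dualAnnihilator := by
  have h : (extDiff α).flip = -extDiff α := by
    ext X Y
    simpa using ((extDiff_isAlt α).neg X Y).symm
  unfold assocSpace
  rw [LinearMap.dualAnnihilator_ker_eq_range_flip, h, LinearMap.range_neg]

/-- Either α vanishes on A(dα), and the characteristic space is all of A(dα), or ker α cuts A(dα) in
a hyperplane, which raises the codimension by one. -/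
theorem cartanClass_eq_or [FiniteDimensional K L] (α : Module.Dual K L) :
    cartanClass α = finrank K (LinearMap.range (extDiff α)) ∨
      cartanClass α = finrank K (LinearMap.range (extDiff α)) + 1 := by
  have h1 := (extDiff α).finrank_range_add_finrank_ker
  have h2 := (charSpace α).finrank_quotient_add_finrank
  unfold cartanClass
  by_cases h : assocSpace α ≤ LinearMap.ker α
  · have : charSpace α = LinearMap.ker (extDiff α) := inf_eq_right.2 h
    rw [this] at h2 ⊢
    left
    omega
  · have hα : α ≠ 0 := by
      rintro rfl
      exact h (by rw [LinearMap.ker_zero]; exact le_top)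
    have h3 := Module.Dual.finrank_ker_add_one_of_ne_zero hα
    have h4 := Submodule.finrank_sup_add_finrank_inf_eq (LinearMap.ker α) (assocSpace α)
    have h5 : finrank K (LinearMap.ker α) <
        finrank K (LinearMap.ker α ⊔ assocSpace α : Submodule K L) :=
      Submodule.finrank_lt_finrank_of_lt (left_lt_sup.2 h)
    have h6 := (LinearMap.ker α ⊔ assocSpace α).finrank_le
    change _ + finrank K (charSpace α) = _ + finrank K (LinearMap.ker (extDiff α)) at h4
    right
    omega

theorem finrank_range_extDiff [CharZero K] [FiniteDimensional K L] (α : Module.Dual K L) :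
    finrank K (LinearMap.range (extDiff α)) = 2 * (cartanClass α / 2) := by
  obtain ⟨k, hk⟩ := even_finrank_range_of_isAlt (extDiff_isAlt α)
  rcases cartanClass_eq_or α with h | h <;> omega

end LinearAlgebra

/-! ### The constant rank theorem, with a linear projection -/

section ConstantRank

open Module Set Filter Topology

variable {E V W : Type*} [NormedAddCommGroup E] [NormedSpace ℝ E] [FiniteDimensional ℝ E]
  [NormedAddCommGroup V] [NormedSpace ℝ V] [NormedAddCommGroup W] [NormedSpace ℝ W]
  [FiniteDimensional ℝ W]

/-- P maps the range of A onto W, and that range is no larger than W, so P is injective there. -/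
theorem eq_zero_of_surjective_comp {A : E →ₗ[ℝ] V} {P : V →ₗ[ℝ] W}
    (hP : Function.Surjective (P ∘ₗ A)) (hA : finrank ℝ (LinearMap.range A) ≤ finrank ℝ W)
    {u : E} (hu : P (A u) = 0) : A u = 0 := by
  have hs : Function.Surjective (P.domRestrict (LinearMap.range A)) := fun w => by
    obtain ⟨v, hv⟩ := hP w
    exact ⟨⟨A v, v, rfl⟩, hv⟩
  have hi : Function.Injective (P.domRestrict (LinearMap.range A)) := by
    refine (LinearMap.injective_iff_surjective_of_finrank_eq_finrank ?_).2 hs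
    exact le_antisymm hA (LinearMap.finrank_le_finrank_of_surjective hs)
  have := @hi ⟨A u, u, rfl⟩ 0 (by simpa using hu)
  simpa using congrArg Subtype.val this

/-- A local form of the constant rank theorem: near a point where the rank of the derivative of `F`
is maximal, `F` factors through the linear projection `P ∘ F`, and `P ∘ F` has a smooth local
section. -/
theorem exists_section_of_constant_rank {Ω : Set E} (hΩ : IsOpen Ω) {e : E} (he : e ∈ Ω)
    {F : E → V} (hF : ContDiffOn ℝ ∞ F Ω)
    (hrank : ∀ x ∈ Ω, finrank ℝ (LinearMap.range (fderiv ℝ F x).toLinearMap) ≤ finrank ℝ W)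
    (P : V →L[ℝ] W) (hP : Function.Surjective (P ∘L fderiv ℝ F e)) :
    ∃ (U : Set E) (T : Set W) (s : W → E), IsOpen U ∧ e ∈ U ∧ U ⊆ Ω ∧ IsOpen T ∧
      ContDiffOn ℝ ∞ s T ∧ (∀ a ∈ T, s a ∈ U ∧ P (F (s a)) = a) ∧
      ∀ x ∈ U, P (F x) ∈ T ∧ F (s (P (F x))) = F x := by
  set g' : E →L[ℝ] W := P ∘L fderiv ℝ F e
  obtain ⟨q, hq⟩ := g'.ker_closedComplemented_of_finiteDimensional_range
  -- Straightening coordinates: `P ∘ F` is completed by a linear projection q onto the kernel of its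
  -- derivative at e, so the derivative of Θ at e is an isomorphism.
  let Θ : E → W × LinearMap.ker g'.toLinearMap := fun x => (P (F x), q x)
  have hΘs : ContDiffOn ℝ ∞ Θ Ω := (P.contDiff.comp_contDiffOn hF).prodMk q.contDiff.contDiffOn
  have hFd : ∀ x ∈ Ω, HasFDerivAt F (fderiv ℝ F x) x := fun x hx =>
    ((hF.contDiffAt (hΩ.mem_nhds hx)).differentiableAt (by simp)).hasFDerivAt
  have hΘd : ∀ x ∈ Ω, HasFDerivAt Θ ((P ∘L fderiv ℝ F x).prod q) x := fun x hx =>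
    (P.hasFDerivAt.comp x (hFd x hx)).prodMk q.hasFDerivAt
  let Θ' : E ≃L[ℝ] W × LinearMap.ker g'.toLinearMap :=
    ContinuousLinearMap.equivProdOfSurjectiveOfIsCompl g' q (LinearMap.range_eq_top.2 hP)
      (LinearMap.range_eq_top.2 fun y => ⟨y, hq y⟩)
      (LinearMap.isCompl_of_proj (f := q.toLinearMap) hq)
  have hΘe : HasFDerivAt Θ (Θ' : E →L[ℝ] W × LinearMap.ker g'.toLinearMap) e := hΘd e he
  have hΘc : ContDiffAt ℝ ∞ Θ e := hΘs.contDiffAt (hΩ.mem_nhds he)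
  let h₁ := hΘc.toOpenPartialHomeomorph Θ hΘe (by simp)
  -- Shrinking to points where the derivative of Θ is invertible makes the local inverse smooth on
  -- its whole domain, not only at the image of e.
  have hΩ' : IsOpen (Ω ∩ fderiv ℝ Θ ⁻¹' range ((↑) : (E ≃L[ℝ] W × LinearMap.ker g'.toLinearMap) →
      E →L[ℝ] W × LinearMap.ker g'.toLinearMap)) :=
    (hΘs.continuousOn_fderiv_of_isOpen hΩ (by simp)).isOpen_inter_preimage hΩ
      ContinuousLinearEquiv.isOpen
  let h := h₁.restrOpen _ hΩ'
  have hcoe : ∀ x, h x = Θ x := fun x => rfl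
  have hsrc : h.source = h₁.source ∩ (Ω ∩ fderiv ℝ Θ ⁻¹' range
    ((↑) : (E ≃L[ℝ] W × LinearMap.ker g'.toLinearMap) → _)) := rfl
  have heh : e ∈ h.source :=
    ⟨hΘc.mem_toOpenPartialHomeomorph_source hΘe (by simp), he, Θ', hΘe.fderiv.symm⟩
  have hsΩ : ∀ x ∈ h.source, x ∈ Ω := fun x hx => hx.2.1
  have hsymm : ∀ p ∈ h.target, ContDiffAt ℝ ∞ h.symm p := fun p hp => by
    obtain ⟨A, hA⟩ := (h.map_target hp).2.2
    have hx := hsΩ _ (h.map_target hp)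
    refine h.contDiffAt_symm (f₀' := A) hp ?_ (hΘs.contDiffAt (hΩ.mem_nhds hx))
    rw [hA, (hΘd _ hx).fderiv]
    exact hΘd _ hx
  obtain ⟨r, hr, hball⟩ := Metric.isOpen_iff.1 h.open_target (h e) (h.map_source heh)
  rw [hcoe] at hball
  have hbox : ∀ a ∈ Metric.ball (P (F e)) r, ∀ b ∈ Metric.ball (q e) r, (a, b) ∈ h.target :=
    fun a ha b hb => hball (by
      rw [← ball_prod_same]
      exact ⟨ha, hb⟩)
  have hright : ∀ p ∈ h.target, (P (F (h.symm p)), q (h.symm p)) = p := fun p hp => h.right_inv hp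
  -- In the coordinates (a, b), F does not depend on b: its b-derivative lies in the range of dF and
  -- is killed by P, hence vanishes, and the slices are convex.
  have hconst : ∀ a ∈ Metric.ball (P (F e)) r, ∀ b ∈ Metric.ball (q e) r,
      F (h.symm (a, b)) = F (h.symm (a, q e)) := by
    intro a ha
    have key : ∀ b ∈ Metric.ball (q e) r, HasFDerivAt (fun b => F (h.symm (a, b)))
        (0 : LinearMap.ker g'.toLinearMap →L[ℝ] V) b := by
      intro b hb
      have hp := hbox a ha b hb
      have hx := hsΩ _ (h.map_target hp)
      have hS := ((hsymm _ hp).differentiableAt (by simp)).hasFDerivAt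
      have hC := (hFd _ hx).comp (a, b) hS
      have hψ := hC.comp b (hasFDerivAt_prodMk_right a b)
      convert! hψ using 1
      ext w : 1
      symm
      simp only [ContinuousLinearMap.comp_apply, zero_apply]
      obtain ⟨A, hA⟩ := (h.map_target hp).2.2
      refine eq_zero_of_surjective_comp (A := (fderiv ℝ F (h.symm (a, b))).toLinearMap)
        (P := P.toLinearMap) ?_ (hrank _ hx) ?_
      -- At nearby points P ∘ dF is still onto, being the first component of the invertible dΘ.
      · intro w
        obtain ⟨v, hv⟩ := A.surjective (w, 0)
        refine ⟨v, ?_⟩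
        rw [(hΘd _ hx).fderiv] at hA
        have := congrArg (fun B => (B v).1) hA
        simp only [ContinuousLinearEquiv.coe_coe, hv] at this
        exact this.symm
      · have h1 := P.hasFDerivAt.comp (a, b) hC
        have h2 : HasFDerivAt (P ∘ F ∘ h.symm)
            (ContinuousLinearMap.fst ℝ W (LinearMap.ker g'.toLinearMap)) (a, b) := by
          refine hasFDerivAt_fst.congr_of_eventuallyEq ?_
          filter_upwards [h.open_target.mem_nhds hp] with p hp
          exact congrArg Prod.fst (hright p hp)
        have := congrArg (fun B => B (0, w)) (h1.unique h2)
        simpa using this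
    intro b hb
    refine Metric.isOpen_ball.is_const_of_fderiv_eq_zero (𝕜 := ℝ)
      (convex_ball (q e) r).isPreconnected
      (fun b hb => (key b hb).differentiableAt.differentiableWithinAt)
      (fun b hb => (key b hb).fderiv) hb (Metric.mem_ball_self hr)
  refine ⟨h.source ∩ h ⁻¹' (Metric.ball (P (F e)) r ×ˢ Metric.ball (q e) r),
    Metric.ball (P (F e)) r, fun a => h.symm (a, q e),
    h.isOpen_inter_preimage (Metric.isOpen_ball.prod Metric.isOpen_ball),
    ⟨heh, Metric.mem_ball_self hr, Metric.mem_ball_self hr⟩, fun x hx => hsΩ x hx.1,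
    Metric.isOpen_ball, ?_, ?_, ?_⟩
  · intro a ha
    have hp := hbox a ha _ (Metric.mem_ball_self hr)
    exact ((hsymm _ hp).comp a (contDiffAt_id.prodMk contDiffAt_const)).contDiffWithinAt
  · intro a ha
    have hp := hbox a ha _ (Metric.mem_ball_self hr)
    refine ⟨⟨h.map_target hp, ?_⟩, congrArg Prod.fst (hright _ hp)⟩
    rw [mem_preimage, h.right_inv hp]
    exact ⟨ha, Metric.mem_ball_self hr⟩
  · rintro x ⟨hx, hxa, hxb⟩
    refine ⟨hxa, ?_⟩
    have h1 := hconst _ hxa _ hxb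
    have h2 : h.symm (h x) = x := h.left_inv hx
    rw [Prod.mk.eta, h2] at h1
    exact h1.symm

end ConstantRank

/-! ### Smoothness of Ad, and multiplication read in a chart -/

section Adjoint

open Set Filter Topology

variable {E : Type*} [NormedAddCommGroup E] [NormedSpace ℝ E]
  {G : Type*} [TopologicalSpace G] [ChartedSpace E G] [Group G]

variable (E) in
/-- The adjoint representation on the model space underlying the Lie algebra. -/
def AdModel (x : G) : E →L[ℝ] E := Ad E x

theorem coAd_eq_comp (x : G) (α : E →L[ℝ] ℝ) : coAd x α = α ∘L AdModel E x⁻¹ := rfl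

theorem AdModel_one : AdModel E (1 : G) = ContinuousLinearMap.id ℝ E := Ad_one

theorem hasFDerivAt_comp_extChartAt_symm {F : Type*} [NormedAddCommGroup F] [NormedSpace ℝ F]
    {f : G → F} {f' : E →L[ℝ] F} (hf : HasMFDerivAt 𝓘(ℝ, E) 𝓘(ℝ, F) f 1 f') :
    HasFDerivAt (f ∘ (extChartAt 𝓘(ℝ, E) (1 : G)).symm) f' (extChartAt 𝓘(ℝ, E) (1 : G) 1) := by
  have h : HasFDerivWithinAt (f ∘ (extChartAt 𝓘(ℝ, E) (1 : G)).symm) f' (range id)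
    (extChartAt 𝓘(ℝ, E) (1 : G) 1) := hf.2
  rwa [range_id, hasFDerivWithinAt_univ] at h

variable (E G) in
/-- The multiplication of `G`, read in the preferred chart at the identity. -/
def chartMul (p : E × E) : E :=
  extChartAt 𝓘(ℝ, E) (1 : G)
    ((extChartAt 𝓘(ℝ, E) (1 : G)).symm p.1 * (extChartAt 𝓘(ℝ, E) (1 : G)).symm p.2)

variable (E G) in
/-- The coordinates of the identity in the preferred chart. -/
def chartOne : E := extChartAt 𝓘(ℝ, E) (1 : G) 1

theorem extChartAt_symm_chartOne :
    (extChartAt 𝓘(ℝ, E) (1 : G)).symm (chartOne E G) = 1 := extChartAt_to_inv 1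

theorem chartOne_mem_target : chartOne E G ∈ (extChartAt 𝓘(ℝ, E) (1 : G)).target :=
  mem_extChartAt_target 1

variable [LieGroup 𝓘(ℝ, E) ∞ G]

theorem contMDiff_conj (x : G) :
    ContMDiff 𝓘(ℝ, E) 𝓘(ℝ, E) ∞ (fun y : G => x * y * x⁻¹) :=
  (contMDiff_const.mul contMDiff_id).mul contMDiff_const

theorem hasMFDerivAt_conj (x : G) {y : G} (hy : y = 1) :
    HasMFDerivAt 𝓘(ℝ, E) 𝓘(ℝ, E) (fun y : G => x * y * x⁻¹) y (AdModel E x) := by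
  subst hy
  exact ((contMDiff_conj x).mdifferentiable (by simp) 1).hasMFDerivAt

theorem AdModel_mul (x y : G) : AdModel E (x * y) = AdModel E x ∘L AdModel E y := by
  have h : (fun z : G => x * y * z * (x * y)⁻¹) =
      (fun z : G => x * z * x⁻¹) ∘ (fun z : G => y * z * y⁻¹) := by
    funext z
    simp [mul_assoc]
  have h1 := (hasMFDerivAt_conj (E := E) x (y := y * 1 * y⁻¹) (by simp)).comp 1
    (hasMFDerivAt_conj y rfl)
  rw [← h] at h1
  exact (hasMFDerivAt_conj (x * y) rfl).mfderiv.symm.trans h1.mfderiv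

theorem coAd_mul (x y : G) (α : E →L[ℝ] ℝ) : coAd (x * y) α = coAd x (coAd y α) := by
  simp only [coAd_eq_comp]
  rw [mul_inv_rev, AdModel_mul]
  rfl

/-- Partial derivatives of a smooth map depend smoothly on the parameter. Conjugation fixes 1, so
source and target tangent spaces are always the one at 1 and the tangent coordinate changes are
trivial. -/
theorem contMDiff_AdModel :
    ContMDiff 𝓘(ℝ, E) 𝓘(ℝ, E →L[ℝ] E) ∞ (AdModel E : G → E →L[ℝ] E) := by
  intro x₀
  have h := ContMDiffAt.mfderiv (I := 𝓘(ℝ, E)) (I' := 𝓘(ℝ, E)) (J := 𝓘(ℝ, E)) (m := ∞) (n := ∞)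
    (x₀ := x₀) (fun x y : G => x * y * x⁻¹) (fun _ => (1 : G))
    (((contMDiff_fst.mul contMDiff_snd).mul contMDiff_fst.inv).contMDiffAt)
    contMDiffAt_const (by simp)
  convert! h using 1
  funext x
  have h1 : ∀ z : G, z * 1 * z⁻¹ = 1 := fun z => by simp
  have h2 : (tangentBundleCore 𝓘(ℝ, E) G).coordChange (achart E 1) (achart E 1) 1 =
      ContinuousLinearMap.id ℝ E := ContinuousLinearMap.ext
    fun v => (tangentBundleCore 𝓘(ℝ, E) G).coordChange_self (achart E 1) 1 (mem_chart_source E 1) v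
  refine Eq.symm ((inTangentCoordinates_eq (I := 𝓘(ℝ, E)) (I' := 𝓘(ℝ, E)) (fun _ => (1 : G))
    (fun x => x * 1 * x⁻¹) (fun x => AdModel E x) (x₀ := x₀) (x := x) (by simp) (by simp)).trans ?_)
  simp only [h1]
  rw [h2, ContinuousLinearMap.comp_id, ContinuousLinearMap.id_comp]

theorem contMDiff_coAd (α : E →L[ℝ] ℝ) :
    ContMDiff 𝓘(ℝ, E) 𝓘(ℝ, E →L[ℝ] ℝ) ∞ (fun x : G => coAd x α) := by
  have h : ContMDiff 𝓘(ℝ, E) 𝓘(ℝ, E →L[ℝ] E) ∞ (fun x : G => AdModel E x⁻¹) :=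
    contMDiff_AdModel.comp (contMDiff_inv _ _)
  exact (ContinuousLinearMap.compL ℝ E E ℝ α).contDiff.contMDiff.comp h

theorem contDiffAt_chartMul : ContDiffAt ℝ ∞ (chartMul E G) (chartOne E G, chartOne E G) := by
  rw [← contMDiffAt_iff_contDiffAt]
  have h1 : ContMDiffAt 𝓘(ℝ, E) 𝓘(ℝ, E) ∞ (extChartAt 𝓘(ℝ, E) (1 : G)).symm (chartOne E G) :=
    (contMDiffOn_extChartAt_symm (1 : G)).contMDiffAt (extChartAt_target_mem_nhds (1 : G))
  have h2 : ContMDiffAt 𝓘(ℝ, E × E) 𝓘(ℝ, E) ∞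
      (fun p : E × E => (extChartAt 𝓘(ℝ, E) (1 : G)).symm p.1) (chartOne E G, chartOne E G) :=
    ContMDiffAt.comp (g := (extChartAt 𝓘(ℝ, E) (1 : G)).symm) (f := Prod.fst)
      (chartOne E G, chartOne E G) h1 contDiff_fst.contMDiff.contMDiffAt
  have h3 : ContMDiffAt 𝓘(ℝ, E × E) 𝓘(ℝ, E) ∞
      (fun p : E × E => (extChartAt 𝓘(ℝ, E) (1 : G)).symm p.2) (chartOne E G, chartOne E G) :=
    ContMDiffAt.comp (g := (extChartAt 𝓘(ℝ, E) (1 : G)).symm) (f := Prod.snd)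
      (chartOne E G, chartOne E G) h1 contDiff_snd.contMDiff.contMDiffAt
  have h4 := h2.mul h3
  refine ContMDiffAt.comp (g := extChartAt 𝓘(ℝ, E) (1 : G)) (chartOne E G, chartOne E G) ?_ h4
  simp only [extChartAt_symm_chartOne, mul_one]
  exact contMDiffAt_extChartAt

theorem hasMFDerivAt_extChartAt_mul_left {a : E}
    (ha : a ∈ (extChartAt 𝓘(ℝ, E) (1 : G)).target)
    (hd : DifferentiableAt ℝ (chartMul E G) (a, chartOne E G)) :
    HasMFDerivAt 𝓘(ℝ, E) 𝓘(ℝ, E)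
      (fun y => extChartAt 𝓘(ℝ, E) (1 : G) ((extChartAt 𝓘(ℝ, E) (1 : G)).symm a * y)) 1
      (fderiv ℝ (chartMul E G) (a, chartOne E G) ∘L ContinuousLinearMap.inr ℝ E E) := by
  have hx : (extChartAt 𝓘(ℝ, E) (1 : G)).symm a * 1 ∈ (chartAt E (1 : G)).source := by
    rw [mul_one, ← extChartAt_source (I := 𝓘(ℝ, E))]
    exact (extChartAt 𝓘(ℝ, E) (1 : G)).map_target ha
  have h1 := ((mdifferentiableAt_extChartAt (I := 𝓘(ℝ, E)) hx).comp (1 : G)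
    ((contMDiff_mul_left (I := 𝓘(ℝ, E)) (n := ∞)).mdifferentiable (by simp) 1)).hasMFDerivAt
  have h2 := hasFDerivAt_comp_extChartAt_symm h1
  have h3 := hd.hasFDerivAt.comp (chartOne E G) (hasFDerivAt_prodMk_right a (chartOne E G))
  have h4 := h2.unique h3
  exact h4 ▸ h1

theorem hasMFDerivAt_extChartAt_mul_right {a : E}
    (ha : a ∈ (extChartAt 𝓘(ℝ, E) (1 : G)).target)
    (hd : DifferentiableAt ℝ (chartMul E G) (chartOne E G, a)) :
    HasMFDerivAt 𝓘(ℝ, E) 𝓘(ℝ, E)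
      (fun y => extChartAt 𝓘(ℝ, E) (1 : G) (y * (extChartAt 𝓘(ℝ, E) (1 : G)).symm a)) 1
      (fderiv ℝ (chartMul E G) (chartOne E G, a) ∘L ContinuousLinearMap.inl ℝ E E) := by
  have hx : 1 * (extChartAt 𝓘(ℝ, E) (1 : G)).symm a ∈ (chartAt E (1 : G)).source := by
    rw [one_mul, ← extChartAt_source (I := 𝓘(ℝ, E))]
    exact (extChartAt 𝓘(ℝ, E) (1 : G)).map_target ha
  have h1 := ((mdifferentiableAt_extChartAt (I := 𝓘(ℝ, E)) hx).comp (1 : G)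
    ((contMDiff_mul_right (I := 𝓘(ℝ, E)) (n := ∞)).mdifferentiable (by simp) 1)).hasMFDerivAt
  have h2 := hasFDerivAt_comp_extChartAt_symm h1
  have h3 := HasFDerivAt.comp (g := chartMul E G) (f := fun b => (b, a)) (chartOne E G)
    hd.hasFDerivAt (hasFDerivAt_prodMk_left (chartOne E G) a)
  have h4 := h2.unique h3
  exact h4 ▸ h1

/-- This is (x y x⁻¹) x = x y, differentiated in y at 1. It characterises Ad through the
multiplication alone, with no chart expression of inversion. -/
theorem fderiv_chartMul_AdModel {a : E} (ha : a ∈ (extChartAt 𝓘(ℝ, E) (1 : G)).target)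
    (hd : DifferentiableAt ℝ (chartMul E G) (a, chartOne E G))
    (hd' : DifferentiableAt ℝ (chartMul E G) (chartOne E G, a)) (w : E) :
    fderiv ℝ (chartMul E G) (chartOne E G, a)
        (AdModel E ((extChartAt 𝓘(ℝ, E) (1 : G)).symm a) w, 0) =
      fderiv ℝ (chartMul E G) (a, chartOne E G) (0, w) := by
  set x := (extChartAt 𝓘(ℝ, E) (1 : G)).symm a
  -- Stated for every y equal to 1 because the chain rule lands at `x * 1 * x⁻¹`.
  have hR : ∀ y : G, y = 1 → HasMFDerivAt 𝓘(ℝ, E) 𝓘(ℝ, E)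
      (fun y => extChartAt 𝓘(ℝ, E) (1 : G) (y * x)) y
      (fderiv ℝ (chartMul E G) (chartOne E G, a) ∘L ContinuousLinearMap.inl ℝ E E) := by
    rintro y rfl
    exact hasMFDerivAt_extChartAt_mul_right ha hd'
  have h1 := (hR (x * 1 * x⁻¹) (by simp)).comp 1 (hasMFDerivAt_conj x rfl)
  have h2 : (fun y => extChartAt 𝓘(ℝ, E) (1 : G) (y * x)) ∘ (fun y : G => x * y * x⁻¹) =
      fun y => extChartAt 𝓘(ℝ, E) (1 : G) (x * y) := by
    funext y
    simp
  rw [h2] at h1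
  have h3 := h1.mfderiv.symm.trans (hasMFDerivAt_extChartAt_mul_left ha hd).mfderiv
  exact congrArg (fun B : E →L[ℝ] E => B w) h3

/-- The left-invariant field at x is the derivative of left translation by x at 1; in the chart this
is the derivative of `chartMul` in its second variable. -/
theorem mpullbackWithin_mulInvariantVectorField {a : E}
    (ha : a ∈ (extChartAt 𝓘(ℝ, E) (1 : G)).target)
    (hd : DifferentiableAt ℝ (chartMul E G) (a, chartOne E G))
    (w : GroupLieAlgebra 𝓘(ℝ, E) G) :
    VectorField.mpullbackWithin 𝓘(ℝ, E) 𝓘(ℝ, E) (extChartAt 𝓘(ℝ, E) (1 : G)).symm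
      (mulInvariantVectorField w) (range 𝓘(ℝ, E)) a =
      fderiv ℝ (chartMul E G) (a, chartOne E G) ((0 : E), (w : E)) := by
  have : IsManifold 𝓘(ℝ, E) 1 G := IsManifold.of_le (n := ∞) (by simp)
  set x := (extChartAt 𝓘(ℝ, E) (1 : G)).symm a
  have hinv := ContinuousLinearMap.inverse_eq
    (mfderivWithin_extChartAt_symm_comp_mfderiv_extChartAt ha)
    (mfderiv_extChartAt_comp_mfderivWithin_extChartAt_symm ha)
  rw [VectorField.mpullbackWithin_apply, hinv]
  have hx : x ∈ (chartAt E (1 : G)).source := by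
    rw [← extChartAt_source (I := 𝓘(ℝ, E))]
    exact (extChartAt 𝓘(ℝ, E) (1 : G)).map_target ha
  have hφ : ∀ y : G, y = x → HasMFDerivAt 𝓘(ℝ, E) 𝓘(ℝ, E) (extChartAt 𝓘(ℝ, E) (1 : G)) y
      (mfderiv 𝓘(ℝ, E) 𝓘(ℝ, E) (extChartAt 𝓘(ℝ, E) (1 : G)) x : E →L[ℝ] E) := by
    rintro y rfl
    exact (mdifferentiableAt_extChartAt hx).hasMFDerivAt
  have h1 := (hφ (x * 1) (mul_one x)).comp (1 : G)
    ((contMDiff_mul_left (I := 𝓘(ℝ, E)) (n := ∞) (a := x)).mdifferentiable (by simp) 1).hasMFDerivAt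
  have h3 := h1.mfderiv.symm.trans (hasMFDerivAt_extChartAt_mul_left ha hd).mfderiv
  exact congrArg (fun B : E →L[ℝ] E => B w) h3

theorem eventually_differentiableAt_chartMul :
    ∀ᶠ a in 𝓝 (chartOne E G), a ∈ (extChartAt 𝓘(ℝ, E) (1 : G)).target ∧
      DifferentiableAt ℝ (chartMul E G) (a, chartOne E G) ∧
      DifferentiableAt ℝ (chartMul E G) (chartOne E G, a) := by
  have h : ∀ᶠ p in 𝓝 (chartOne E G, chartOne E G), DifferentiableAt ℝ (chartMul E G) p := by
    filter_upwards [((contDiffAt_chartMul (E := E) (G := G)).of_le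
      (m := 1) (by simp)).eventually (by simp)] with p hp
    exact hp.differentiableAt (by simp)
  have h1 : Tendsto (fun a : E => (a, chartOne E G)) (𝓝 (chartOne E G))
      (𝓝 (chartOne E G, chartOne E G)) := (by fun_prop : Continuous _).tendsto' _ _ rfl
  have h2 : Tendsto (fun a : E => (chartOne E G, a)) (𝓝 (chartOne E G))
      (𝓝 (chartOne E G, chartOne E G)) := (by fun_prop : Continuous _).tendsto' _ _ rfl
  filter_upwards [extChartAt_target_mem_nhds (I := 𝓘(ℝ, E)) (1 : G), h1.eventually h, h2.eventually h]
    with a h1 h2 h3 using ⟨h1, h2, h3⟩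

end Adjoint

/-! ### The differential of Ad is the bracket -/

section AdjointDerivative

open Set Filter Topology Module

variable {E : Type*} [NormedAddCommGroup E] [NormedSpace ℝ E]
  {G : Type*} [TopologicalSpace G] [ChartedSpace E G] [Group G] [LieGroup 𝓘(ℝ, E) ∞ G]

theorem two_le_infty : (2 : WithTop ℕ∞) ≤ ∞ := (inferInstance : ENat.LEInfty (2 : WithTop ℕ∞)).out

theorem hasFDerivAt_fderiv_chartMul :
    HasFDerivAt (fderiv ℝ (chartMul E G))
      (fderiv ℝ (fderiv ℝ (chartMul E G)) (chartOne E G, chartOne E G))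
      (chartOne E G, chartOne E G) :=
  ((contDiffAt_chartMul.fderiv_right (m := 1)
    (by rw [one_add_one_eq_two]; exact two_le_infty)).differentiableAt (by simp)).hasFDerivAt

theorem fderiv_chartMul_one_left (w : E) :
    fderiv ℝ (chartMul E G) (chartOne E G, chartOne E G) (0, w) = w := by
  have h1 := (contDiffAt_chartMul (E := E) (G := G)).differentiableAt (by simp)
  have h2 := HasFDerivAt.comp (g := chartMul E G) (f := fun b => (chartOne E G, b)) (chartOne E G)
    h1.hasFDerivAt (hasFDerivAt_prodMk_right (chartOne E G) (chartOne E G))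
  have h3 : HasFDerivAt (chartMul E G ∘ fun b => (chartOne E G, b)) (ContinuousLinearMap.id ℝ E)
      (chartOne E G) := by
    refine (hasFDerivAt_id _).congr_of_eventuallyEq ?_
    filter_upwards [extChartAt_target_mem_nhds (I := 𝓘(ℝ, E)) (1 : G)] with b hb
    simp only [Function.comp_apply, chartMul, extChartAt_symm_chartOne, one_mul, id_eq]
    exact (extChartAt 𝓘(ℝ, E) (1 : G)).right_inv hb
  exact congrArg (fun B : E →L[ℝ] E => B w) (h2.unique h3)

theorem fderiv_chartMul_one_right (w : E) :
    fderiv ℝ (chartMul E G) (chartOne E G, chartOne E G) (w, 0) = w := by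
  have h1 := (contDiffAt_chartMul (E := E) (G := G)).differentiableAt (by simp)
  have h2 := HasFDerivAt.comp (g := chartMul E G) (f := fun b => (b, chartOne E G)) (chartOne E G)
    h1.hasFDerivAt (hasFDerivAt_prodMk_left (chartOne E G) (chartOne E G))
  have h3 : HasFDerivAt (chartMul E G ∘ fun b => (b, chartOne E G)) (ContinuousLinearMap.id ℝ E)
      (chartOne E G) := by
    refine (hasFDerivAt_id _).congr_of_eventuallyEq ?_
    filter_upwards [extChartAt_target_mem_nhds (I := 𝓘(ℝ, E)) (1 : G)] with b hb
    simp only [Function.comp_apply, chartMul, extChartAt_symm_chartOne, mul_one, id_eq]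
    exact (extChartAt 𝓘(ℝ, E) (1 : G)).right_inv hb
  exact congrArg (fun B : E →L[ℝ] E => B w) (h2.unique h3)

theorem hasFDerivAt_fderiv_chartMul_left (w : E) :
    HasFDerivAt (fun a => fderiv ℝ (chartMul E G) (a, chartOne E G) (0, w))
      (((ContinuousLinearMap.apply ℝ E ((0 : E), w)) ∘L
        fderiv ℝ (fderiv ℝ (chartMul E G)) (chartOne E G, chartOne E G)) ∘L
          ContinuousLinearMap.inl ℝ E E) (chartOne E G) :=
  ((ContinuousLinearMap.apply ℝ E ((0 : E), w)).hasFDerivAt.comp _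
    hasFDerivAt_fderiv_chartMul).comp (f := fun a => (a, chartOne E G)) (chartOne E G)
    (hasFDerivAt_prodMk_left (chartOne E G) (chartOne E G))

/-- The bracket of two left-invariant fields, computed in the chart, antisymmetrises the mixed
second derivative of the multiplication. -/
theorem lie_eq_fderiv_chartMul (v w : GroupLieAlgebra 𝓘(ℝ, E) G) :
    (⁅v, w⁆ : GroupLieAlgebra 𝓘(ℝ, E) G) =
      fderiv ℝ (fderiv ℝ (chartMul E G)) (chartOne E G, chartOne E G)
        ((v : E), (0 : E)) ((0 : E), (w : E)) -
      fderiv ℝ (fderiv ℝ (chartMul E G)) (chartOne E G, chartOne E G)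
        ((w : E), (0 : E)) ((0 : E), (v : E)) := by
  have : IsManifold 𝓘(ℝ, E) 1 G := IsManifold.of_le (n := ∞) (by simp)
  have hV : ∀ u : GroupLieAlgebra 𝓘(ℝ, E) G,
      (VectorField.mpullbackWithin 𝓘(ℝ, E) 𝓘(ℝ, E) (extChartAt 𝓘(ℝ, E) (1 : G)).symm
        (mulInvariantVectorField u) (range 𝓘(ℝ, E)) : E → E) =ᶠ[𝓝 (chartOne E G)]
      fun a => fderiv ℝ (chartMul E G) (a, chartOne E G) ((0 : E), (u : E)) := fun u => by
    filter_upwards [eventually_differentiableAt_chartMul] with a ha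
    exact mpullbackWithin_mulInvariantVectorField ha.1 ha.2.1 u
  have h1 : (⁅v, w⁆ : GroupLieAlgebra 𝓘(ℝ, E) G) = VectorField.lieBracketWithin ℝ
      (VectorField.mpullbackWithin 𝓘(ℝ, E) 𝓘(ℝ, E) (extChartAt 𝓘(ℝ, E) (1 : G)).symm
        (mulInvariantVectorField v) (range 𝓘(ℝ, E)) : E → E)
      (VectorField.mpullbackWithin 𝓘(ℝ, E) 𝓘(ℝ, E) (extChartAt 𝓘(ℝ, E) (1 : G)).symm
        (mulInvariantVectorField w) (range 𝓘(ℝ, E)) : E → E)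
      univ (chartOne E G) := by
    rw [GroupLieAlgebra.bracket_def, ← VectorField.mlieBracketWithin_univ,
      VectorField.mlieBracketWithin_apply, mfderiv_extChartAt_self]
    erw [ContinuousLinearMap.inverse_id]
    simp only [preimage_univ, univ_inter, modelWithCornersSelf_coe, range_id]
    rfl
  refine h1.trans ?_
  refine (congrFun (VectorField.lieBracketWithin_univ (𝕜 := ℝ) (E := E)) _).trans
    (((hV v).lieBracket_vectorField_eq (hV w)).trans ?_)
  have h2 := (hasFDerivAt_fderiv_chartMul_left (E := E) (G := G) w).fderiv
  have h3 := (hasFDerivAt_fderiv_chartMul_left (E := E) (G := G) v).fderiv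
  have h4 := fderiv_chartMul_one_left (E := E) (G := G) w
  have h5 := fderiv_chartMul_one_left (E := E) (G := G) v
  refine (congrArg₂ (· - ·) (congrArg₂ (fun (B : E →L[ℝ] E) (u : E) => B u) h2 h5)
    (congrArg₂ (fun (B : E →L[ℝ] E) (u : E) => B u) h3 h4))

theorem differentiableAt_AdModel_chart :
    DifferentiableAt ℝ (fun a => AdModel E ((extChartAt 𝓘(ℝ, E) (1 : G)).symm a))
      (chartOne E G) := by
  have h := ((contMDiff_AdModel (E := E) (G := G)).mdifferentiable (by simp) 1).hasMFDerivAt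
  exact (hasFDerivAt_comp_extChartAt_symm h).differentiableAt

/-- Differentiate `fderiv_chartMul_AdModel` in a at the identity, in direction v. The product rule
on the Ad side gives the derivative of Ad plus a mixed second derivative, which symmetry of the
second derivative turns into the subtracted term. -/
theorem fderiv_AdModel_eq_fderiv_chartMul (v w : E) :
    fderiv ℝ (fun a => AdModel E ((extChartAt 𝓘(ℝ, E) (1 : G)).symm a)) (chartOne E G) v w =
      fderiv ℝ (fderiv ℝ (chartMul E G)) (chartOne E G, chartOne E G) (v, 0) (0, w) -
      fderiv ℝ (fderiv ℝ (chartMul E G)) (chartOne E G, chartOne E G) (w, 0) (0, v) := by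
  have hC := contDiffAt_chartMul (E := E) (G := G)
  have hsymm : IsSymmSndFDerivAt ℝ (chartMul E G) (chartOne E G, chartOne E G) :=
    hC.isSymmSndFDerivAt
      (by rw [minSmoothness_of_isRCLikeNormedField]; exact two_le_infty)
  have hL := hasFDerivAt_fderiv_chartMul_left (E := E) (G := G) w
  have hA := (differentiableAt_AdModel_chart (E := E) (G := G)).hasFDerivAt
  have hAw := (ContinuousLinearMap.inl ℝ E E).hasFDerivAt.comp (chartOne E G)
    ((ContinuousLinearMap.apply ℝ E (w : E)).hasFDerivAt.comp (chartOne E G) hA)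
  have hR := (HasFDerivAt.comp (g := fderiv ℝ (chartMul E G)) (f := fun a => (chartOne E G, a))
    (chartOne E G) hasFDerivAt_fderiv_chartMul
    (hasFDerivAt_prodMk_right (chartOne E G) (chartOne E G))).clm_apply hAw
  have hLR := hL.unique (hR.congr_of_eventuallyEq (by
    filter_upwards [eventually_differentiableAt_chartMul] with a ha
    exact (fderiv_chartMul_AdModel ha.1 ha.2.1 ha.2.2 w).symm))
  have h := congrArg (fun B : E →L[ℝ] E => B v) hLR
  have hAe : AdModel E ((extChartAt 𝓘(ℝ, E) (1 : G)).symm (chartOne E G)) =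
      ContinuousLinearMap.id ℝ E := by rw [extChartAt_symm_chartOne, AdModel_one]
  simp only [ContinuousLinearMap.comp_apply, add_apply,
    ContinuousLinearMap.flip_apply, Function.comp_apply, ContinuousLinearMap.apply_apply,
    ContinuousLinearMap.inl_apply, ContinuousLinearMap.inr_apply] at h
  rw [hAe, ContinuousLinearMap.id_apply, fderiv_chartMul_one_right, hsymm (0, v) (w, 0)] at h
  rw [h]
  abel

/-- The differential of the adjoint representation at the identity is the Lie bracket. -/
theorem fderiv_AdModel (v w : GroupLieAlgebra 𝓘(ℝ, E) G) :
    fderiv ℝ (fun a => AdModel E ((extChartAt 𝓘(ℝ, E) (1 : G)).symm a)) (chartOne E G) v w =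
      (⁅v, w⁆ : GroupLieAlgebra 𝓘(ℝ, E) G) :=
  (fderiv_AdModel_eq_fderiv_chartMul (E := E) (G := G) v w).trans
    (lie_eq_fderiv_chartMul v w).symm

end AdjointDerivative

/-! ### The differential of the coadjoint orbit map and its constant rank -/

section CoadjointDerivative

open Set Filter Topology Module

variable {E : Type*} [NormedAddCommGroup E] [NormedSpace ℝ E]
  {G : Type*} [TopologicalSpace G] [ChartedSpace E G] [Group G]

variable (G) in
/-- The differential at the identity of the orbit map `x ↦ Ad*(x)α`, with values in `𝔤*`. -/
def coadDeriv (α : E →L[ℝ] ℝ) : E →L[ℝ] E →L[ℝ] ℝ :=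
  mfderiv 𝓘(ℝ, E) 𝓘(ℝ, E →L[ℝ] ℝ) (fun x : G => coAd x α) 1

/-- The coadjoint action of `x` as a continuous linear map. -/
def coAdL (x : G) : (E →L[ℝ] ℝ) →L[ℝ] E →L[ℝ] ℝ :=
  (ContinuousLinearMap.compL ℝ E E ℝ).flip (AdModel E x⁻¹)

theorem coAdL_apply (x : G) (α : E →L[ℝ] ℝ) : coAdL x α = coAd x α := rfl

theorem finrank_range_comp_comp_le {E₁ E₂ V₁ V₂ : Type*} [AddCommGroup E₁] [Module ℝ E₁]
    [AddCommGroup E₂] [Module ℝ E₂] [AddCommGroup V₁] [Module ℝ V₁] [AddCommGroup V₂] [Module ℝ V₂]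
    [FiniteDimensional ℝ E₂] (A : V₁ →ₗ[ℝ] V₂) (f : E₂ →ₗ[ℝ] V₁) (B : E₁ →ₗ[ℝ] E₂) :
    finrank ℝ (LinearMap.range (A ∘ₗ f ∘ₗ B)) ≤ finrank ℝ (LinearMap.range f) := by
  refine le_trans (Submodule.finrank_mono (t := (LinearMap.range f).map A) ?_)
    (Submodule.finrank_map_le A _)
  rintro _ ⟨u, rfl⟩
  exact ⟨f (B u), ⟨B u, rfl⟩, rfl⟩

variable [LieGroup 𝓘(ℝ, E) ∞ G]

theorem hasMFDerivAt_coAd_one (α : E →L[ℝ] ℝ) {x : G} (hx : x = 1) :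
    HasMFDerivAt 𝓘(ℝ, E) 𝓘(ℝ, E →L[ℝ] ℝ) (fun x : G => coAd x α) x
      (coadDeriv (E := E) G α) := by
  subst hx
  exact ((contMDiff_coAd α).mdifferentiable (by simp) 1).hasMFDerivAt

/-- The composite Ad*(x)α ∘ Ad(x) is constantly α, so the product rule at 1 makes the two
derivatives cancel. -/
theorem coadDeriv_apply_model (α : E →L[ℝ] ℝ) (v w : E) :
    coadDeriv G α v w = -α (fderiv ℝ (fun a => AdModel E ((extChartAt 𝓘(ℝ, E) (1 : G)).symm a))
      (chartOne E G) v w) := by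
  have hF := hasFDerivAt_comp_extChartAt_symm (hasMFDerivAt_coAd_one (G := G) α rfl)
  have hA := (differentiableAt_AdModel_chart (E := E) (G := G)).hasFDerivAt
  have hFA := hF.clm_comp hA
  have hc : HasFDerivAt (fun _ : E => α) (0 : E →L[ℝ] E →L[ℝ] ℝ) (chartOne E G) :=
    hasFDerivAt_const _ _
  have h := hFA.unique (hc.congr_of_eventuallyEq (Eventually.of_forall fun a => by
    simp only [Function.comp_apply, coAd_eq_comp]
    rw [ContinuousLinearMap.comp_assoc, ← AdModel_mul, inv_mul_cancel, AdModel_one,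
      ContinuousLinearMap.comp_id]))
  have h' := congrArg (fun B : E →L[ℝ] E →L[ℝ] ℝ => B v w) h
  have h1 : (extChartAt 𝓘(ℝ, E) (1 : G)).symm (extChartAt 𝓘(ℝ, E) (1 : G) 1) = 1 :=
    extChartAt_symm_chartOne
  simp only [Function.comp_apply, h1, coAd_one, AdModel_one, add_apply,
    ContinuousLinearMap.comp_apply, ContinuousLinearMap.compL_apply,
    zero_apply] at h'
  exact eq_neg_of_add_eq_zero_right h'

theorem coadDeriv_apply [CompleteSpace E] (α : E →L[ℝ] ℝ) (v w : GroupLieAlgebra 𝓘(ℝ, E) G) :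
    coadDeriv G α v w = extDiff (toLinearForm G α) v w :=
  (coadDeriv_apply_model (G := G) α (v : E) (w : E)).trans
    (congrArg (fun u : E => -α u) (fderiv_AdModel v w))

/-- Equivariance, Ad*(y)α = Ad*(x)Ad*(x⁻¹y)α, bounds the rank at x by the rank at 1. The next lemma
is the reverse translation, which bounds it from below. -/
theorem hasMFDerivAt_coAd (α : E →L[ℝ] ℝ) (x : G) :
    HasMFDerivAt 𝓘(ℝ, E) 𝓘(ℝ, E →L[ℝ] ℝ) (fun x : G => coAd x α) x
      (coAdL x ∘L coadDeriv G α ∘L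
        (mfderiv 𝓘(ℝ, E) 𝓘(ℝ, E) (fun y : G => x⁻¹ * y) x : E →L[ℝ] E)) := by
  have h1 : HasMFDerivAt 𝓘(ℝ, E) 𝓘(ℝ, E) (fun y : G => x⁻¹ * y) x
      (mfderiv 𝓘(ℝ, E) 𝓘(ℝ, E) (fun y : G => x⁻¹ * y) x) :=
    ((contMDiff_mul_left (n := ∞)).mdifferentiable (by simp) x).hasMFDerivAt
  have h2 := (hasMFDerivAt_coAd_one (G := G) α (x := x⁻¹ * x) (by simp)).comp x h1
  have h3 := ((coAdL x).hasFDerivAt (x := coAd (x⁻¹ * x) α)).hasMFDerivAt.comp x h2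
  convert! h3 using 1
  funext y
  simp [coAdL_apply, ← coAd_mul]

theorem coadDeriv_eq_of_hasMFDerivAt_coAd (α : E →L[ℝ] ℝ) (x : G) {f' : E →L[ℝ] E →L[ℝ] ℝ}
    (hf' : HasMFDerivAt 𝓘(ℝ, E) 𝓘(ℝ, E →L[ℝ] ℝ) (fun x : G => coAd x α) x f') :
    coadDeriv G α = coAdL x⁻¹ ∘L f' ∘L
      (mfderiv 𝓘(ℝ, E) 𝓘(ℝ, E) (fun y : G => x * y) 1 : E →L[ℝ] E) := by
  have h1 : HasMFDerivAt 𝓘(ℝ, E) 𝓘(ℝ, E) (fun y : G => x * y) 1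
      (mfderiv 𝓘(ℝ, E) 𝓘(ℝ, E) (fun y : G => x * y) 1) :=
    ((contMDiff_mul_left (n := ∞)).mdifferentiable (by simp) 1).hasMFDerivAt
  have h0 : ∀ z : G, z = x → HasMFDerivAt 𝓘(ℝ, E) 𝓘(ℝ, E →L[ℝ] ℝ) (fun x : G => coAd x α) z f' := by
    rintro z rfl
    exact hf'
  have h2 := (h0 (x * 1) (mul_one x)).comp (1 : G) h1
  have h3 := ((coAdL x⁻¹).hasFDerivAt (x := coAd (x * 1) α)).hasMFDerivAt.comp (1 : G) h2
  have h4 : (coAdL x⁻¹ ∘ (fun x : G => coAd x α) ∘ fun y => x * y) = fun x : G => coAd x α := by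
    funext y
    simp [coAdL_apply, ← coAd_mul]
  rw [h4] at h3
  exact h3.mfderiv

theorem finrank_range_le_of_hasMFDerivAt_coAd [FiniteDimensional ℝ E] (α : E →L[ℝ] ℝ) (x : G)
    {f' : E →L[ℝ] E →L[ℝ] ℝ}
    (hf' : HasMFDerivAt 𝓘(ℝ, E) 𝓘(ℝ, E →L[ℝ] ℝ) (fun x : G => coAd x α) x f') :
    finrank ℝ (LinearMap.range (coadDeriv G α).toLinearMap) ≤
      finrank ℝ (LinearMap.range f'.toLinearMap) := by
  rw [coadDeriv_eq_of_hasMFDerivAt_coAd α x hf']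
  exact finrank_range_comp_comp_le (coAdL x⁻¹).toLinearMap f'.toLinearMap
    (mfderiv 𝓘(ℝ, E) 𝓘(ℝ, E) (fun y : G => x * y) 1 : E →L[ℝ] E).toLinearMap

variable (G) in
/-- The coadjoint orbit map, read in the preferred chart at the identity. -/
def coAdChart (α : E →L[ℝ] ℝ) (a : E) : E →L[ℝ] ℝ :=
  coAd ((extChartAt 𝓘(ℝ, E) (1 : G)).symm a) α

theorem contDiffOn_coAdChart (α : E →L[ℝ] ℝ) :
    ContDiffOn ℝ ∞ (coAdChart G α) (extChartAt 𝓘(ℝ, E) (1 : G)).target := by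
  rw [← contMDiffOn_iff_contDiffOn]
  exact (contMDiff_coAd α).comp_contMDiffOn (contMDiffOn_extChartAt_symm (1 : G))

theorem fderiv_coAdChart_chartOne (α : E →L[ℝ] ℝ) :
    fderiv ℝ (coAdChart G α) (chartOne E G) = coadDeriv G α :=
  (hasFDerivAt_comp_extChartAt_symm (hasMFDerivAt_coAd_one (G := G) α rfl)).fderiv

theorem finrank_range_fderiv_coAdChart_le [FiniteDimensional ℝ E] (α : E →L[ℝ] ℝ) {a : E}
    (ha : a ∈ (extChartAt 𝓘(ℝ, E) (1 : G)).target) :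
    finrank ℝ (LinearMap.range (fderiv ℝ (coAdChart G α) a).toLinearMap) ≤
      finrank ℝ (LinearMap.range (coadDeriv G α).toLinearMap) := by
  let B : E →L[ℝ] E := mfderiv 𝓘(ℝ, E) 𝓘(ℝ, E)
    (fun y : G => ((extChartAt 𝓘(ℝ, E) (1 : G)).symm a)⁻¹ * y)
    ((extChartAt 𝓘(ℝ, E) (1 : G)).symm a)
  let C : E →L[ℝ] E := mfderiv 𝓘(ℝ, E) 𝓘(ℝ, E) (extChartAt 𝓘(ℝ, E) (1 : G)).symm a
  have h1 : HasMFDerivAt 𝓘(ℝ, E) 𝓘(ℝ, E) (extChartAt 𝓘(ℝ, E) (1 : G)).symm a C :=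
    (((contMDiffOn_extChartAt_symm (I := 𝓘(ℝ, E)) (n := ∞) (1 : G)).contMDiffAt
      ((isOpen_extChartAt_target (I := 𝓘(ℝ, E)) (1 : G)).mem_nhds ha)).mdifferentiableAt (by simp)).hasMFDerivAt
  let D : E →L[ℝ] E →L[ℝ] ℝ :=
    coAdL ((extChartAt 𝓘(ℝ, E) (1 : G)).symm a) ∘L coadDeriv G α ∘L B ∘L C
  have h2 : HasMFDerivAt 𝓘(ℝ, E) 𝓘(ℝ, E →L[ℝ] ℝ) (coAdChart G α) a D :=
    (hasMFDerivAt_coAd α ((extChartAt 𝓘(ℝ, E) (1 : G)).symm a)).comp a h1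
  have h3 : HasFDerivAt (coAdChart G α) D a := hasMFDerivAt_iff_hasFDerivAt.1 h2
  rw [h3.fderiv]
  exact finrank_range_comp_comp_le (coAdL ((extChartAt 𝓘(ℝ, E) (1 : G)).symm a)).toLinearMap
    (coadDeriv G α).toLinearMap (B ∘L C).toLinearMap

end CoadjointDerivative

/-! ### σ-compactness of connected groups; atlases cut out by linear projections -/

section ImmersedAtlas

open Set Filter Topology

/-- A connected locally compact group is σ-compact. -/
theorem sigmaCompactSpace_of_connected (G : Type*) [TopologicalSpace G] [Group G]
    [IsTopologicalGroup G] [ConnectedSpace G] [WeaklyLocallyCompactSpace G] :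
    SigmaCompactSpace G := by
  open scoped Pointwise in
  obtain ⟨K, hK, hK1⟩ := exists_compact_mem_nhds (1 : G)
  have hL : IsCompact (K ∪ K⁻¹) := hK.union hK.inv
  have hpow : ∀ n : ℕ, IsCompact ((K ∪ K⁻¹) ^ n) := fun n => by
    induction n with
    | zero => simp
    | succ n ih => rw [pow_succ]; exact ih.mul hL
  refine ⟨⟨fun n => (K ∪ K⁻¹) ^ n, hpow, iUnion_eq_univ_iff.2 fun x => ?_⟩⟩
  -- A subgroup containing a neighbourhood of 1 is open, hence closed, hence everything; its
  -- elements are finite words in K ∪ K⁻¹.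
  have hopen : IsOpen (Subgroup.closure K : Set G) :=
    Subgroup.isOpen_of_mem_nhds _ (mem_of_superset hK1 Subgroup.subset_closure)
  have huniv : (Subgroup.closure K : Set G) = univ :=
    IsClopen.eq_univ ⟨Subgroup.isClosed_of_isOpen _ hopen, hopen⟩ ⟨1, one_mem _⟩
  have hx : x ∈ (Subgroup.closure K).toSubmonoid := by
    change x ∈ (Subgroup.closure K : Set G)
    rw [huniv]
    trivial
  rw [Subgroup.closure_toSubmonoid] at hx
  induction hx using Submonoid.closure_induction with
  | mem x hx => exact ⟨1, by simpa using hx⟩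
  | one => exact ⟨0, by simp⟩
  | mul x y _ _ hx hy =>
    obtain ⟨m, hm⟩ := hx
    obtain ⟨n, hn⟩ := hy
    exact ⟨m + n, by rw [pow_add]; exact Set.mul_mem_mul hm hn⟩

/-- An atlas on `X` whose charts are given by linear maps composed with a map `ι : X → V`, and such
that `ι` is smooth in these charts. -/
structure ImmersedAtlas {X V : Type*} [TopologicalSpace X] [NormedAddCommGroup V] [NormedSpace ℝ V]
    (ι : X → V) (W : Type*) [NormedAddCommGroup W] [NormedSpace ℝ W] where
  /-- The chart at a point. -/
  chart : X → OpenPartialHomeomorph X W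
  /-- The linear map that gives the chart at a point. -/
  proj : X → V →L[ℝ] W
  mem_source : ∀ x, x ∈ (chart x).source
  chart_apply : ∀ x y, chart x y = proj x (ι y)
  contDiffOn_symm : ∀ x, ContDiffOn ℝ ∞ (ι ∘ (chart x).symm) (chart x).target

namespace ImmersedAtlas

variable {X V W : Type*} [TopologicalSpace X] [NormedAddCommGroup V] [NormedSpace ℝ V]
  [NormedAddCommGroup W] [NormedSpace ℝ W] {ι : X → V} (A : ImmersedAtlas ι W)

/-- The charted space structure of an `ImmersedAtlas`. -/
abbrev chartedSpace : ChartedSpace W X where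
  atlas := range A.chart
  chartAt := A.chart
  mem_chart_source := A.mem_source
  chart_mem_atlas x := mem_range_self x

theorem isManifold : @IsManifold ℝ _ W _ _ W _ 𝓘(ℝ, W) ∞ X _ A.chartedSpace := by
  let _ := A.chartedSpace
  refine isManifold_of_contDiffOn _ _ _ ?_
  rintro _ _ ⟨x, rfl⟩ ⟨y, rfl⟩
  simp only [modelWithCornersSelf_coe, modelWithCornersSelf_coe_symm, Function.id_comp,
    Function.comp_id, range_id, preimage_id, inter_univ]
  -- Each transition map is a linear map after a smooth parametrisation into V.
  have h : ContDiffOn ℝ ∞ (A.proj y ∘ (ι ∘ (A.chart x).symm)) (A.chart x).target :=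
    (A.proj y).contDiff.comp_contDiffOn (A.contDiffOn_symm x)
  refine (h.mono fun p hp => hp.1).congr fun p hp => ?_
  simp [A.chart_apply]

theorem contMDiff :
    @ContMDiff ℝ _ W _ _ W _ 𝓘(ℝ, W) X _ A.chartedSpace V _ _ V _ 𝓘(ℝ, V) V _ _ ∞ ι := by
  let _ := A.chartedSpace
  have := A.isManifold
  intro x
  have h1 : ContMDiffOn 𝓘(ℝ, W) 𝓘(ℝ, V) ∞ (ι ∘ (A.chart x).symm) (A.chart x).target :=
    (A.contDiffOn_symm x).contMDiffOn
  have h2 : ContMDiffOn 𝓘(ℝ, W) 𝓘(ℝ, W) ∞ (A.chart x) (A.chart x).source :=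
    contMDiffOn_chart (x := x)
  have h3 := h1.comp h2 fun y hy => (A.chart x).map_source hy
  refine (h3.congr fun y hy => ?_).contMDiffAt
    ((A.chart x).open_source.mem_nhds (A.mem_source x))
  simp [(A.chart x).left_inv hy]

/-- The chart at x is `A.proj x ∘ ι`, so the linear projection is a left inverse of dι at x. -/
theorem injective_mfderiv (x : X) :
    letI := A.chartedSpace
    Function.Injective (mfderiv 𝓘(ℝ, W) 𝓘(ℝ, V) ι x) := by
  let _ := A.chartedSpace
  have := A.isManifold
  have : IsManifold 𝓘(ℝ, W) 1 X := IsManifold.of_le (n := ∞) (by simp)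
  have h1 := (A.contMDiff.mdifferentiable (by simp) x).hasMFDerivAt
  have h2 := ((A.proj x).hasFDerivAt (x := ι x)).hasMFDerivAt.comp x h1
  have h3 : A.proj x ∘ ι = extChartAt 𝓘(ℝ, W) x := by
    funext y
    exact (A.chart_apply x y).symm
  rw [h3] at h2
  have h4 := h2.mfderiv.symm.trans mfderiv_extChartAt_self
  intro v w hvw
  have hv := congrArg (fun B : W →L[ℝ] W => B v) h4
  have hw := congrArg (fun B : W →L[ℝ] W => B w) h4
  exact hv.symm.trans ((congrArg (A.proj x) hvw).trans hw)

theorem contMDiff_of_comp {E M : Type*} [NormedAddCommGroup E] [NormedSpace ℝ E]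
    [TopologicalSpace M] [ChartedSpace E M] {f : M → X} (hf : Continuous f)
    (hιf : ContMDiff 𝓘(ℝ, E) 𝓘(ℝ, V) ∞ (ι ∘ f)) :
    letI := A.chartedSpace
    ContMDiff 𝓘(ℝ, E) 𝓘(ℝ, W) ∞ f := by
  let _ := A.chartedSpace
  intro x
  rw [contMDiffAt_iff_target]
  refine ⟨hf.continuousAt, ?_⟩
  have h := ((A.proj (f x)).contDiff.contMDiff.comp hιf) x
  convert! h using 1
  funext y
  exact A.chart_apply (f x) (f y)

end ImmersedAtlas

end ImmersedAtlas

/-! ### The manifold structure of the orbit -/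

section OrbitManifold

open Set Filter Topology Module

variable {E : Type*} [NormedAddCommGroup E] [NormedSpace ℝ E]
  {G : Type*} [TopologicalSpace G] [ChartedSpace E G] [Group G]

theorem orbitMap_surjective (α : E →L[ℝ] ℝ) : Function.Surjective (orbitMap (G := G) α) := by
  rintro ⟨_, x, rfl⟩
  exact ⟨x, rfl⟩

/-- The quotient topology on the orbit. -/
abbrev orbitTopology (α : E →L[ℝ] ℝ) : TopologicalSpace (CoadjointOrbit G α) :=
  TopologicalSpace.coinduced (orbitMap α) ‹_›

theorem continuous_orbitMap (α : E →L[ℝ] ℝ) : Continuous[_, orbitTopology α] (orbitMap (G := G) α) :=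
  continuous_coinduced_rng

theorem orbitMap_one (α : E →L[ℝ] ℝ) : orbitMap α (1 : G) = orbitBase G α :=
  Subtype.ext (coAd_one α)

theorem IsOrbitManifold.exists_comp {α : E →L[ℝ] ℝ} {d : ℕ}
    [TopologicalSpace (CoadjointOrbit G α)]
    [ChartedSpace (EuclideanSpace ℝ (Fin d)) (CoadjointOrbit G α)] (h : IsOrbitManifold G α d) :
    ∃ (J : EuclideanSpace ℝ (Fin d) →L[ℝ] E →L[ℝ] ℝ) (Q : E →L[ℝ] EuclideanSpace ℝ (Fin d)),
      Function.Injective J ∧ Function.Surjective Q ∧ coadDeriv G α = J ∘L Q ∧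
      orbitTangentSpace G α d = range J := by
  let J : EuclideanSpace ℝ (Fin d) →L[ℝ] E →L[ℝ] ℝ :=
    mfderiv (𝓡 d) 𝓘(ℝ, E →L[ℝ] ℝ) (orbitIncl (G := G) α) (orbitBase G α)
  let Q : E →L[ℝ] EuclideanSpace ℝ (Fin d) :=
    mfderiv 𝓘(ℝ, E) (𝓡 d) (orbitMap (G := G) α) 1
  have hJ : ∀ β, β = orbitBase G α →
      HasMFDerivAt (𝓡 d) 𝓘(ℝ, E →L[ℝ] ℝ) (orbitIncl (G := G) α) β J := by
    rintro _ rfl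
    exact (h.contMDiff_incl.mdifferentiable (by simp) _).hasMFDerivAt
  have hQ : HasMFDerivAt 𝓘(ℝ, E) (𝓡 d) (orbitMap (G := G) α) 1 Q :=
    (h.contMDiff_orbitMap.mdifferentiable (by simp) _).hasMFDerivAt
  have hJQ := (hJ _ (orbitMap_one α)).comp 1 hQ
  exact ⟨J, Q, h.injective_incl _, h.surjective_orbitMap _, hJQ.mfderiv, rfl⟩

theorem IsOrbitManifold.eq_finrank {α : E →L[ℝ] ℝ} {d : ℕ}
    [TopologicalSpace (CoadjointOrbit G α)]
    [ChartedSpace (EuclideanSpace ℝ (Fin d)) (CoadjointOrbit G α)] (h : IsOrbitManifold G α d) :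
    d = finrank ℝ (LinearMap.range (coadDeriv G α).toLinearMap) := by
  obtain ⟨J, Q, hJ, hQ, hc, -⟩ := h.exists_comp
  have h1 : LinearMap.range (coadDeriv G α).toLinearMap = LinearMap.range J.toLinearMap := by
    rw [hc]
    exact LinearMap.range_comp_of_range_eq_top J.toLinearMap (LinearMap.range_eq_top.2 hQ)
  rw [h1, LinearMap.finrank_range_of_inj hJ, finrank_euclideanSpace_fin]

theorem IsOrbitManifold.orbitTangentSpace_eq {α : E →L[ℝ] ℝ} {d : ℕ}
    [TopologicalSpace (CoadjointOrbit G α)]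
    [ChartedSpace (EuclideanSpace ℝ (Fin d)) (CoadjointOrbit G α)] (h : IsOrbitManifold G α d) :
    orbitTangentSpace G α d = range (coadDeriv G α) := by
  obtain ⟨J, Q, hJ, hQ, hc, ht⟩ := h.exists_comp
  rw [ht, hc, ContinuousLinearMap.coe_comp, hQ.range_comp]

variable [LieGroup 𝓘(ℝ, E) ∞ G]

attribute [local instance] orbitTopology

theorem continuous_orbitIncl (α : E →L[ℝ] ℝ) : Continuous (orbitIncl (G := G) α) :=
  continuous_coinduced_dom.2 (contMDiff_coAd α).continuous

theorem isOpenMap_orbitMap (α : E →L[ℝ] ℝ) : IsOpenMap (orbitMap (G := G) α) := by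
  have : IsTopologicalGroup G := topologicalGroup_of_lieGroup 𝓘(ℝ, E) ∞
  intro O hO
  rw [isOpen_coinduced]
  -- Fibres are left cosets of the stabiliser, so the saturation of O is a union of right
  -- translates.
  have h : orbitMap α ⁻¹' (orbitMap α '' O) = ⋃ z ∈ {z : G | coAd z α = α}, (· * z) ⁻¹' O := by
    ext y
    simp only [mem_preimage, mem_image, mem_ofPred_eq, mem_iUnion, exists_prop]
    constructor
    · rintro ⟨x, hx, hxy⟩
      have hxy' : coAd x α = coAd y α := congrArg Subtype.val hxy
      refine ⟨y⁻¹ * x, ?_, by simpa using hx⟩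
      rw [coAd_mul, hxy', ← coAd_mul, inv_mul_cancel, coAd_one]
    · rintro ⟨z, hz, hyz⟩
      refine ⟨y * z, hyz, Subtype.ext ?_⟩
      change coAd (y * z) α = coAd y α
      rw [coAd_mul, hz]
  rw [h]
  exact isOpen_biUnion fun z _ => hO.preimage (continuous_mul_const z)

theorem exists_surjective_comp_of_finrank_range {E V : Type*} [NormedAddCommGroup E]
    [NormedSpace ℝ E] [FiniteDimensional ℝ E] [NormedAddCommGroup V] [NormedSpace ℝ V]
    (B : E →L[ℝ] V) :
    ∃ P : V →L[ℝ] EuclideanSpace ℝ (Fin (finrank ℝ (LinearMap.range B.toLinearMap))),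
      Function.Surjective (P ∘L B) := by
  obtain ⟨q, hq⟩ := Submodule.ClosedComplemented.of_finiteDimensional
    (LinearMap.range B.toLinearMap)
  let φ : LinearMap.range B.toLinearMap ≃ₗ[ℝ]
      EuclideanSpace ℝ (Fin (finrank ℝ (LinearMap.range B.toLinearMap))) :=
    LinearEquiv.ofFinrankEq _ _ (by simp)
  refine ⟨LinearMap.toContinuousLinearMap φ.toLinearMap ∘L q, fun w => ?_⟩
  obtain ⟨⟨_, v, rfl⟩, rfl⟩ := φ.surjective w
  exact ⟨v, congrArg φ (hq ⟨_, v, rfl⟩)⟩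

/-- The constant rank theorem gives a chart around α; the chart at β = Ad*(x)α is obtained by first
moving β back with Ad*(x⁻¹), which is linear on 𝔤*. -/
theorem nonempty_immersedAtlas [FiniteDimensional ℝ E] (α : E →L[ℝ] ℝ) :
    Nonempty (ImmersedAtlas (orbitIncl (G := G) α)
      (EuclideanSpace ℝ (Fin (finrank ℝ (LinearMap.range (coadDeriv G α).toLinearMap))))) := by
  have : IsTopologicalGroup G := topologicalGroup_of_lieGroup 𝓘(ℝ, E) ∞
  set W := EuclideanSpace ℝ (Fin (finrank ℝ (LinearMap.range (coadDeriv G α).toLinearMap)))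
  set φ := extChartAt 𝓘(ℝ, E) (1 : G) with hφ
  obtain ⟨P, hP⟩ := exists_surjective_comp_of_finrank_range (coadDeriv G α)
  obtain ⟨U, T, s, hU, heU, hUΩ, hT, hs, hsT, hUT⟩ := exists_section_of_constant_rank
    (isOpen_extChartAt_target (I := 𝓘(ℝ, E)) (1 : G)) chartOne_mem_target
    (contDiffOn_coAdChart (G := G) α)
    (fun a ha => (finrank_range_fderiv_coAdChart_le α ha).trans (by simp)) P
    (by rw [fderiv_coAdChart_chartOne]; exact hP)
  choose x hx using orbitMap_surjective (G := G) α
  have hcoAd : ∀ (z : G) (a : E), coAd z⁻¹ (coAd (z * φ.symm a) α) = coAdChart G α a := fun z a => by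
    rw [← coAd_mul, inv_mul_cancel_left]
    rfl
  have hφU : IsOpen (φ.source ∩ φ ⁻¹' U) := isOpen_extChartAt_preimage' (1 : G) hU
  have hφU' : ∀ a ∈ U, φ.symm a ∈ φ.source ∩ φ ⁻¹' U := fun a ha =>
    ⟨φ.map_target (hUΩ ha), by rw [mem_preimage, φ.right_inv (hUΩ ha)]; exact ha⟩
  have hsrc : ∀ z : G, orbitMap α '' ((z⁻¹ * ·) ⁻¹' (φ.source ∩ φ ⁻¹' U)) =
      {γ | ∃ a ∈ U, orbitMap α (z * φ.symm a) = γ} := fun z => by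
    ext γ
    constructor
    · rintro ⟨y, ⟨hy, hyU⟩, rfl⟩
      refine ⟨φ (z⁻¹ * y), hyU, ?_⟩
      rw [φ.left_inv hy, mul_inv_cancel_left]
    · rintro ⟨a, ha, rfl⟩
      exact ⟨z * φ.symm a, by simpa using hφU' a ha, rfl⟩
  have hsec : ∀ (z : G) (a : E), a ∈ U →
      orbitMap α (z * φ.symm (s (P (coAdChart G α a)))) = orbitMap α (z * φ.symm a) :=
    fun z a ha => Subtype.ext (by
      change coAd _ _ = coAd _ _
      rw [coAd_mul, coAd_mul]
      exact congrArg (coAd z) (hUT a ha).2)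
  let chart : CoadjointOrbit G α → OpenPartialHomeomorph (CoadjointOrbit G α) W := fun β =>
    { toFun := fun γ => P (coAd (x β)⁻¹ γ.1)
      invFun := fun a => orbitMap α (x β * φ.symm (s a))
      source := {γ | ∃ a ∈ U, orbitMap α (x β * φ.symm a) = γ}
      target := T
      map_source' := by
        rintro _ ⟨a, ha, rfl⟩
        simpa only [orbitMap, hcoAd] using (hUT a ha).1
      map_target' := fun a ha => ⟨s a, (hsT a ha).1, rfl⟩
      left_inv' := by
        rintro _ ⟨a, ha, rfl⟩
        simp only [orbitMap, hcoAd]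
        exact hsec _ a ha
      right_inv' := fun a ha => by
        simp only [orbitMap, hcoAd]
        exact (hsT a ha).2
      open_source := by
        rw [← hsrc]
        exact isOpenMap_orbitMap α _ (hφU.preimage (continuous_const_mul _))
      open_target := hT
      continuousOn_toFun :=
        ((P ∘L coAdL (x β)⁻¹).continuous.comp (continuous_orbitIncl α)).continuousOn
      continuousOn_invFun := by
        have h1 : ContinuousOn (fun a => φ.symm (s a)) T :=
          (continuousOn_extChartAt_symm (1 : G)).comp hs.continuousOn
            fun a ha => hUΩ (hsT a ha).1
        exact (continuous_orbitMap α).comp_continuousOn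
          ((continuous_const_mul (x β)).comp_continuousOn h1) }
  refine ⟨⟨chart, fun β => P ∘L coAdL (x β)⁻¹, fun β => ?_, fun β γ => rfl, fun β => ?_⟩⟩
  · refine ⟨chartOne E G, heU, ?_⟩
    rw [hφ, extChartAt_symm_chartOne, mul_one, hx]
  · have h1 : ContDiffOn ℝ ∞ (coAdChart G α ∘ s) T :=
      (contDiffOn_coAdChart α).comp hs fun a ha => hUΩ (hsT a ha).1
    have h2 : ContDiffOn ℝ ∞ (coAdL (x β) ∘ (coAdChart G α ∘ s)) T :=
      (coAdL (x β)).contDiff.comp_contDiffOn h1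
    refine h2.congr fun a _ => ?_
    exact coAd_mul _ _ _

theorem ImmersedAtlas.isOrbitManifold [FiniteDimensional ℝ E] [ConnectedSpace G] {α : E →L[ℝ] ℝ}
    {d : ℕ} (A : ImmersedAtlas (orbitIncl (G := G) α) (EuclideanSpace ℝ (Fin d)))
    (hd : d = finrank ℝ (LinearMap.range (coadDeriv G α).toLinearMap)) :
    letI := A.chartedSpace
    IsOrbitManifold G α d := by
  let _ := A.chartedSpace
  have : IsTopologicalGroup G := topologicalGroup_of_lieGroup 𝓘(ℝ, E) ∞
  have : LocallyCompactSpace G := ChartedSpace.locallyCompactSpace E G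
  have : SigmaCompactSpace G := sigmaCompactSpace_of_connected G
  have : SecondCountableTopology G := ChartedSpace.secondCountable_of_sigmaCompact E G
  have hι : ContMDiff (𝓡 d) 𝓘(ℝ, E →L[ℝ] ℝ) ∞ (orbitIncl (G := G) α) := A.contMDiff
  have hπ : ContMDiff 𝓘(ℝ, E) (𝓡 d) ∞ (orbitMap (G := G) α) :=
    A.contMDiff_of_comp (continuous_orbitMap α) (contMDiff_coAd α)
  refine ⟨A.isManifold, ?_, ?_, hι, A.injective_mfderiv, hπ, fun x => ?_⟩
  · exact T2Space.of_injective_continuous Subtype.val_injective (continuous_orbitIncl α)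
  · exact ((isOpenMap_orbitMap α).isQuotientMap (continuous_orbitMap α)
      (orbitMap_surjective α)).secondCountableTopology (isOpenMap_orbitMap α)
  -- Submersivity is a rank count: J ∘ Q has rank at least d at every x, so Q is onto a
  -- d-dimensional space.
  · let J : EuclideanSpace ℝ (Fin d) →L[ℝ] E →L[ℝ] ℝ :=
      mfderiv (𝓡 d) 𝓘(ℝ, E →L[ℝ] ℝ) (orbitIncl (G := G) α) (orbitMap α x)
    let Q : E →L[ℝ] EuclideanSpace ℝ (Fin d) := mfderiv 𝓘(ℝ, E) (𝓡 d) (orbitMap (G := G) α) x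
    have hJ : HasMFDerivAt (𝓡 d) 𝓘(ℝ, E →L[ℝ] ℝ) (orbitIncl (G := G) α) (orbitMap α x) J :=
      (hι.mdifferentiable (by simp) _).hasMFDerivAt
    have hQ : HasMFDerivAt 𝓘(ℝ, E) (𝓡 d) (orbitMap (G := G) α) x Q :=
      (hπ.mdifferentiable (by simp) _).hasMFDerivAt
    have h1 : finrank ℝ (LinearMap.range (coadDeriv G α).toLinearMap) ≤
        finrank ℝ (LinearMap.range (J ∘L Q).toLinearMap) :=
      finrank_range_le_of_hasMFDerivAt_coAd α x (hJ.comp x hQ)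
    have h2 : finrank ℝ (LinearMap.range (J ∘L Q).toLinearMap) ≤
        finrank ℝ (LinearMap.range Q.toLinearMap) :=
      finrank_range_comp_comp_le J.toLinearMap Q.toLinearMap LinearMap.id
    have h3 : LinearMap.range Q.toLinearMap = ⊤ := by
      refine Submodule.eq_top_of_finrank_eq (le_antisymm (Submodule.finrank_le _) ?_)
      rw [finrank_euclideanSpace_fin]
      exact hd.le.trans (h1.trans h2)
    exact (LinearMap.range_eq_top.1 h3 : Function.Surjective Q)

theorem orbitHasDim_finrank [FiniteDimensional ℝ E] [ConnectedSpace G] (α : E →L[ℝ] ℝ) :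
    OrbitHasDim G α (finrank ℝ (LinearMap.range (coadDeriv G α).toLinearMap)) := by
  obtain ⟨A⟩ := nonempty_immersedAtlas (G := G) α
  exact ⟨orbitTopology α, A.chartedSpace, A.isOrbitManifold rfl⟩

theorem orbitHasDim_iff [FiniteDimensional ℝ E] [ConnectedSpace G] (α : E →L[ℝ] ℝ) (d : ℕ) :
    OrbitHasDim G α d ↔ d = finrank ℝ (LinearMap.range (coadDeriv G α).toLinearMap) := by
  constructor
  · rintro ⟨_, _, h⟩
    exact h.eq_finrank
  · rintro rfl
    exact orbitHasDim_finrank α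

end OrbitManifold

/-! ### From the orbit map's differential to dα -/

section CartanClassOrbit

open Set Module

variable {E : Type*} [NormedAddCommGroup E] [NormedSpace ℝ E] [CompleteSpace E]
  {G : Type*} [TopologicalSpace G] [ChartedSpace E G] [Group G] [LieGroup 𝓘(ℝ, E) ∞ G]

theorem extDiff_toLinearForm (α : E →L[ℝ] ℝ) :
    extDiff (toLinearForm G α) =
      ((ContinuousLinearMap.coeLM ℝ : (E →L[ℝ] ℝ) →ₗ[ℝ] Dual ℝ E) ∘ₗ
        (coadDeriv G α).toLinearMap : E →ₗ[ℝ] Dual ℝ E) :=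
  LinearMap.ext₂ fun v w => (coadDeriv_apply α v w).symm

/-- The two maps differ only by the injection of the continuous dual into the algebraic dual. -/
theorem finrank_range_coadDeriv (α : E →L[ℝ] ℝ) :
    finrank ℝ (LinearMap.range (coadDeriv G α).toLinearMap) =
      finrank ℝ (LinearMap.range (extDiff (toLinearForm G α))) := by
  rw [extDiff_toLinearForm]
  refine (LinearEquiv.finrank_eq (Submodule.equivMapOfInjective
    (ContinuousLinearMap.coeLM ℝ : (E →L[ℝ] ℝ) →ₗ[ℝ] Dual ℝ E)
    ContinuousLinearMap.coe_injective _)).trans ?_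
  rw [← LinearMap.range_comp]
  rfl

theorem range_coadDeriv [FiniteDimensional ℝ E] (α : E →L[ℝ] ℝ) :
    range (coadDeriv G α) =
      {β | ∀ X ∈ assocSpace (toLinearForm G α), toLinearForm G β X = 0} := by
  have : FiniteDimensional ℝ (GroupLieAlgebra 𝓘(ℝ, E) G) := ‹FiniteDimensional ℝ E›
  ext β
  have h : toLinearForm G β ∈ LinearMap.range (extDiff (toLinearForm G α)) ↔
      ∀ X ∈ assocSpace (toLinearForm G α), toLinearForm G β X = 0 := by
    rw [range_extDiff, Submodule.mem_dualAnnihilator]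
  refine Iff.trans ?_ h
  constructor
  · rintro ⟨v, rfl⟩
    exact ⟨v, LinearMap.ext fun w => (coadDeriv_apply α v w).symm⟩
  · rintro ⟨v, hv⟩
    exact ⟨v, ContinuousLinearMap.ext fun w =>
      (coadDeriv_apply α v w).trans (LinearMap.congr_fun hv w)⟩

end CartanClassOrbit

end CoadjointClass

end

theorem mainTheorem1 {n : ℕ} {G : Type*} [TopologicalSpace G]
    [ChartedSpace (EuclideanSpace ℝ (Fin n)) G] [Group G] [LieGroup (𝓡 n) ∞ G] [ConnectedSpace G]
    (α : EuclideanSpace ℝ (Fin n) →L[ℝ] ℝ) (hα : α ≠ 0) :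
    (∀ p : ℕ, CoadjointClass.OrbitHasDim G α (2 * p) ↔
      CoadjointClass.cartanClass (CoadjointClass.toLinearForm G α) = 2 * p ∨
        CoadjointClass.cartanClass (CoadjointClass.toLinearForm G α) = 2 * p + 1) ∧
    (∀ d : ℕ, CoadjointClass.OrbitHasDim G α d ↔
      d = 2 * (CoadjointClass.cartanClass (CoadjointClass.toLinearForm G α) / 2)) ∧
    (∀ (d : ℕ) [TopologicalSpace (CoadjointClass.CoadjointOrbit G α)]
      [ChartedSpace (EuclideanSpace ℝ (Fin d)) (CoadjointClass.CoadjointOrbit G α)],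
      CoadjointClass.IsOrbitManifold G α d →
      CoadjointClass.orbitTangentSpace G α d =
        {β | ∀ X ∈ CoadjointClass.assocSpace (CoadjointClass.toLinearForm G α),
          CoadjointClass.toLinearForm G β X = 0}) := by
  have : FiniteDimensional ℝ (GroupLieAlgebra (𝓡 n) G) :=
    (inferInstance : FiniteDimensional ℝ (EuclideanSpace ℝ (Fin n)))
  have hdim : ∀ d : ℕ, CoadjointClass.OrbitHasDim G α d ↔
      d = 2 * (CoadjointClass.cartanClass (CoadjointClass.toLinearForm G α) / 2) := fun d => by
    rw [CoadjointClass.orbitHasDim_iff, CoadjointClass.finrank_range_coadDeriv,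
      CoadjointClass.finrank_range_extDiff]
  refine ⟨fun p => ?_, hdim, fun d _ _ h => ?_⟩
  · rw [hdim]
    omega
  · rw [h.orbitTangentSpace_eq, CoadjointClass.range_coadDeriv]
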